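/- Let $\mathbb{F}_q$ be a finite field with $q$ elements, and let $\Omega(f)$ be the number of monic irreducible factors of $f\in\mathbb{F}_q[t]$, counted with multiplicity. For $z\in\mathbb{C}$ with $|z|<q$ put $$H(z)=\frac{1}{\Gamma(z+1)}\prod_{p}\left(1-\frac{1}{q^{\deg p}}\right)^{z}\left(1-\frac{z}{q^{\deg p}}\right)^{-1},$$ where $p$ runs over the monic irreducible polynomials in $\mathbb{F}_q[t]$ and $1/\Gamma$ is the entire function that vanishes at $0,-1,-2,\dots$. The product converges unconditionally for every $|z|<q$. Moreover, for every real $\epsilon\in(0,q)$ there is a constant $C$, depending only on $\epsilon$ and on the fixed field $\mathbb{F}_q$, such that for all $z\in\mathbb{C}$ with $|z|\le q-\epsilon$ and all integers $n\ge 1$, $$\sum_{\substack{f\in\mathbb{F}_q[t]\ \text{monic}\\ \deg f=n}}z^{\Omega(f)}=q^{n}n^{z-1}\bigl(zH(z)+E\bigr)\quad\text{for some } E=E(z,n)\in\mathbb{C}\text{ with } |E|\le \frac{C}{n}.$$ -/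

import Mathlib

open Polynomial

noncomputable section

/-- The set of monic polynomials of degree `n` over `F`. -/
def monicsOfDegree (F : Type*) [Field F] (n : ℕ) : Set F[X] :=
  {f | f.Monic ∧ f.natDegree = n}

theorem monicsOfDegree_finite (F : Type*) [Field F] [Fintype F] (n : ℕ) :
    (monicsOfDegree F n).Finite := by
  have e : {p : F[X] // p.Monic ∧ p.natDegree = n} ≃ (Fin n → F) :=
    (monicEquivDegreeLT n).trans (degreeLTEquiv F n).toEquiv
  exact Set.finite_coe_iff.mp (Finite.of_equiv _ e.symm)

/-- The monic irreducible polynomials over `F`. -/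
abbrev MonicIrreducible (F : Type*) [Field F] : Type _ :=
  {p : F[X] // p.Monic ∧ Irreducible p}

open Classical in
/-- `Ω(f)`: the number of monic irreducible factors of `f`, counted with multiplicity. -/
def bigOmega {F : Type*} [Field F] (f : F[X]) : ℕ :=
  Multiset.card (UniqueFactorizationMonoid.normalizedFactors f)

/-- `M_z(n) = ∑ z ^ Ω(f)`, the sum being over the monic polynomials `f` of degree `n`. -/
def omegaSum (F : Type*) [Field F] [Fintype F] (z : ℂ) (n : ℕ) : ℂ :=
  ∑ f ∈ (monicsOfDegree_finite F n).toFinset, z ^ bigOmega f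

/-- The factor `(1 - 1 / q ^ deg p) ^ z * (1 - z / q ^ deg p)⁻¹` of the Euler product of `H`,
where `q = #F`. -/
def eulerFactor (F : Type*) [Field F] [Fintype F] (z : ℂ) (p : MonicIrreducible F) : ℂ :=
  (1 - 1 / (Fintype.card F : ℂ) ^ p.1.natDegree) ^ z *
    (1 - z / (Fintype.card F : ℂ) ^ p.1.natDegree)⁻¹

/-- `H(z)`, for `|z| < q`. At the poles of `Γ(z + 1)` the value of `Complex.Gamma` is `0`, so that
`1 / Γ(z + 1)` is `0` there, in agreement with the entire function `1 / Γ`. -/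
def eulerH (F : Type*) [Field F] [Fintype F] (z : ℂ) : ℂ :=
  1 / Complex.Gamma (z + 1) * ∏' p : MonicIrreducible F, eulerFactor F z p

end

/-!
The proof is the Selberg–Delange method, carried out on coefficients instead of contour integrals.
Let `F(u) = ∑_f z ^ Ω(f) u ^ deg f`, the sum being over the monic polynomials. Weighting every `f`
by its degree `∑_{p ^ j ∣ f} deg p` gives Newton's identity `n M(n) = ∑_k b_k M(n - k)`
(`omegaSum_recurrence`), where `M(n)` is the coefficient of `F` and `b_k = ∑_{p, j} deg p * z ^ j`
runs over the prime powers `p ^ j` of degree `k`. For `z = 1` the coefficients are `q ^ n`, and the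
identity yields `∑_{d ∣ k} d π(d) = q ^ k`. Hence `c_k = b_k - z q ^ k` only involves prime powers
with `j ≥ 2`, and `∑ |c_k| r ^ k` is bounded, uniformly in `|z| ≤ A < q`, for some radius
`r > 1 / q` (`sum_norm_primePowerSum_sub_mul_pow_le`).

In terms of formal power series, `F(u) = (1 - q u) ^ (-z) G(u)` with `G = exp (∑ c_k u ^ k / k)`
(`exists_omegaSum_eq_conv`). The coefficients of `G` are `O(r ^ (-k))`, since they satisfy a
recurrence with coefficients `c_k` (`norm_mul_pow_le_of_recurrence`), and `G(1 / q)` is the Euler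
product in `H(z)` (`tsum_mul_pow_eq_exp_of_recurrence`, `hasProd_eulerFactor`). The coefficients
`q ^ m z (z + 1) ⋯ (z + m - 1) / m!` of `(1 - q u) ^ (-z)` are
`q ^ m m ^ (z - 1) (1 / Γ(z) + O(1 / m))` uniformly, by Euler's limit formula for `Γ` (`exists_norm_negBinomCoeff_mul_cpow_sub_le`). In the
convolution of the two coefficient sequences, the shift from `n - k` to `n` costs a factor
`O((1 + k) ^ S / n)` (`exists_norm_shifted_negBinomCoeff_sub_le`), which is summable against the
geometrically decaying `g_k q ^ (-k)`; and `1 / Γ(z) = z / Γ(z + 1)`.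
-/

/-! ### Uniform asymptotics of the coefficients of `(1 - u) ^ (-z)` -/

/-- The coefficient of `u ^ m` in `(1 - u) ^ (-z)`, that is, `z (z + 1) ⋯ (z + m - 1) / m!`. -/
noncomputable def negBinomCoeff (z : ℂ) (m : ℕ) : ℂ := ∏ j ∈ Finset.range m, (z + j) / (j + 1)

theorem negBinomCoeff_zero (z : ℂ) : negBinomCoeff z 0 = 1 := by simp [negBinomCoeff]

theorem negBinomCoeff_succ (z : ℂ) (m : ℕ) :
    negBinomCoeff z (m + 1) = negBinomCoeff z m * ((z + m) / (m + 1)) := by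
  rw [negBinomCoeff, Finset.prod_range_succ, negBinomCoeff]

/-- `(1 + z x) (1 + x) ^ (-z) = 1 + O(x ^ 2)`, uniformly in `‖z‖ ≤ A`. -/
theorem norm_one_add_mul_mul_exp_sub_one_le {A x : ℝ} {z : ℂ} (hz : ‖z‖ ≤ A) (hx0 : 0 < x)
    (hx1 : x ≤ 1) :
    ‖(1 + z * x) * Complex.exp (-(z * (Real.log (1 + x) : ℝ))) - 1‖ ≤
      Real.exp A * (A + A ^ 2 * Real.exp A) * x ^ 2 := by
  have hA : 0 ≤ A := (norm_nonneg z).trans hz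
  have hl0 : 0 ≤ Real.log (1 + x) := Real.log_nonneg (by linarith)
  have hl1 : Real.log (1 + x) ≤ x := by
    have := Real.log_le_sub_one_of_pos (show 0 < 1 + x by linarith)
    linarith
  have hl2 : x - Real.log (1 + x) ≤ x ^ 2 := by
    have h1 := Real.one_sub_inv_le_log_of_pos (show 0 < 1 + x by linarith)
    have h2 : x - (1 - (1 + x)⁻¹) = x ^ 2 * (1 + x)⁻¹ := by
      field_simp
      ring
    have h3 : (1 + x)⁻¹ ≤ 1 := inv_le_one_of_one_le₀ (by linarith)
    nlinarith [sq_nonneg x]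
  set w : ℂ := z * (Real.log (1 + x) : ℝ) with hw
  have hwx : ‖w‖ ≤ A * x := by
    rw [hw, norm_mul, Complex.norm_real, Real.norm_of_nonneg hl0]
    gcongr
  have hwA : ‖w‖ ≤ A := hwx.trans (by nlinarith)
  have e1 : (1 + z * x) * Complex.exp (-w) - 1 =
      Complex.exp (-w) * (z * ((x - Real.log (1 + x) : ℝ) : ℂ) - (Complex.exp w - (1 + w))) := by
    have : Complex.exp (-w) * Complex.exp w = 1 := by rw [← Complex.exp_add]; simp
    push_cast
    rw [hw] at *
    linear_combination this
  have h1 : ‖Complex.exp (-w)‖ ≤ Real.exp A := by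
    refine (Complex.norm_exp_le_exp_norm _).trans ?_
    rw [norm_neg]
    gcongr
  have h2 : ‖Complex.exp w - (1 + w)‖ ≤ (A * x) ^ 2 * Real.exp A := by
    have := Complex.norm_exp_sub_sum_le_norm_mul_exp w 2
    simp only [Finset.sum_range_succ, Finset.sum_range_zero, pow_zero, pow_one, Nat.factorial,
      zero_add, Nat.cast_one, div_one, mul_one] at this
    refine this.trans ?_
    gcongr
  have h3 : ‖z * ((x - Real.log (1 + x) : ℝ) : ℂ)‖ ≤ A * x ^ 2 := by
    rw [norm_mul, Complex.norm_real, Real.norm_of_nonneg (by linarith)]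
    gcongr
  rw [e1, norm_mul]
  calc _ ≤ Real.exp A * (A * x ^ 2 + (A * x) ^ 2 * Real.exp A) := by
        gcongr
        exact (norm_sub_le _ _).trans (add_le_add h3 h2)
    _ = _ := by ring

theorem natCast_cpow_eq_exp_log {n : ℕ} (hn : 1 ≤ n) (s : ℂ) :
    (n : ℂ) ^ s = Complex.exp ((Real.log n : ℝ) * s) := by
  rw [Complex.cpow_def_of_ne_zero (by exact_mod_cast (by omega : n ≠ 0)), Complex.natCast_log]

/-- The normalised coefficient `negBinomCoeff z n * n ^ (1 - z)` satisfies a first-order recurrence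
whose multiplier is `1 + O(1 / n ^ 2)`. -/
theorem norm_negBinomCoeff_mul_cpow_succ_sub_le {A : ℝ} {z : ℂ} (hz : ‖z‖ ≤ A) {n : ℕ}
    (hn : 1 ≤ n) :
    ‖negBinomCoeff z (n + 1) * ((n + 1 : ℕ) : ℂ) ^ (1 - z) - negBinomCoeff z n * (n : ℂ) ^ (1 - z)‖
      ≤ Real.exp A * (A + A ^ 2 * Real.exp A) * (1 / (n : ℝ)) ^ 2 *
        ‖negBinomCoeff z n * (n : ℂ) ^ (1 - z)‖ := by
  have hn' : (0 : ℝ) < n := by exact_mod_cast hn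
  have hnC : (n : ℂ) ≠ 0 := by exact_mod_cast (by omega : n ≠ 0)
  have hn1C : (n : ℂ) + 1 ≠ 0 := by exact_mod_cast (by omega : n + 1 ≠ 0)
  have key := norm_one_add_mul_mul_exp_sub_one_le hz (x := 1 / (n : ℝ)) (by positivity)
    (by rw [div_le_one hn']; exact_mod_cast hn)
  have hlog : Real.log ((n + 1 : ℕ) : ℝ) = Real.log n + Real.log (1 + 1 / (n : ℝ)) := by
    rw [← Real.log_mul hn'.ne' (by positivity)]
    congr 1
    field_simp
    push_cast
    ring
  have e : negBinomCoeff z (n + 1) * ((n + 1 : ℕ) : ℂ) ^ (1 - z) -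
      negBinomCoeff z n * (n : ℂ) ^ (1 - z) =
      ((1 + z * ((1 / (n : ℝ) : ℝ) : ℂ)) *
        Complex.exp (-(z * (Real.log (1 + 1 / (n : ℝ)) : ℝ))) - 1) *
      (negBinomCoeff z n * (n : ℂ) ^ (1 - z)) := by
    have h1 : ((n + 1 : ℕ) : ℂ) ^ (1 - z) = ((n + 1 : ℕ) : ℂ) * ((n : ℂ) ^ (-z) *
        Complex.exp (-(z * (Real.log (1 + 1 / (n : ℝ)) : ℝ)))) := by
      rw [sub_eq_add_neg, Complex.cpow_add _ _ (by exact_mod_cast (by omega : n + 1 ≠ 0)),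
        Complex.cpow_one, natCast_cpow_eq_exp_log (by omega), natCast_cpow_eq_exp_log hn, hlog,
        ← Complex.exp_add]
      congr 2
      push_cast
      ring
    have h2 : (n : ℂ) ^ (1 - z) = n * (n : ℂ) ^ (-z) := by
      rw [sub_eq_add_neg, Complex.cpow_add _ _ hnC, Complex.cpow_one]
    rw [h1, h2, negBinomCoeff_succ]
    push_cast
    field_simp
    ring
  rw [e, norm_mul]
  gcongr

/-- Euler's limit formula for `1 / Γ(z)`, valid at the poles of `Γ` too. -/
theorem tendsto_negBinomCoeff_mul_cpow (z : ℂ) :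
    Filter.Tendsto (fun n : ℕ => negBinomCoeff z n * (n : ℂ) ^ (1 - z)) Filter.atTop
      (nhds (1 / Complex.Gamma z)) := by
  by_cases hG : Complex.Gamma z = 0
  -- at a pole `z = -m` of `Γ` both `1 / Γ(z)` and the coefficients with `n > m` are zero
  · obtain ⟨m, hm⟩ := (Complex.Gamma_eq_zero_iff z).1 hG
    rw [hG, div_zero]
    refine tendsto_const_nhds.congr' ?_
    filter_upwards [Filter.eventually_gt_atTop m] with n hn
    rw [negBinomCoeff, Finset.prod_eq_zero (Finset.mem_range.2 hn), zero_mul]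
    simp [hm]
  · have h1 : Filter.Tendsto (fun n : ℕ => (Complex.GammaSeq z n)⁻¹ * ((n : ℂ) / (n + z)))
        Filter.atTop (nhds (1 / Complex.Gamma z)) := by
      have h2 : Filter.Tendsto (fun n : ℕ => (n : ℂ) / (n + z)) Filter.atTop (nhds 1) :=
        tendsto_natCast_div_add_atTop z
      simpa using ((Complex.GammaSeq_tendsto_Gamma z).inv₀ hG).mul h2
    refine h1.congr' ?_
    filter_upwards [Filter.eventually_ge_atTop 1] with n hn
    have hnC : (n : ℂ) ≠ 0 := by exact_mod_cast (by omega : n ≠ 0)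
    have hz : (n : ℂ) + z ≠ 0 := by
      intro h
      exact hG ((Complex.Gamma_eq_zero_iff z).2 ⟨n, by linear_combination h⟩)
    have hfac : (∏ j ∈ Finset.range n, ((j : ℂ) + 1)) = (n.factorial : ℂ) := by
      rw [← Finset.prod_range_add_one_eq_factorial]
      push_cast
      rfl
    have hf0 : (n.factorial : ℂ) ≠ 0 := by exact_mod_cast n.factorial_ne_zero
    have hp0 : (n : ℂ) ^ z ≠ 0 := by simp [Complex.cpow_eq_zero_iff, hnC]
    rw [Complex.GammaSeq, negBinomCoeff, Finset.prod_div_distrib, hfac, Finset.prod_range_succ,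
      Complex.cpow_sub _ _ hnC, Complex.cpow_one, add_comm z (n : ℂ)]
    field_simp

/-- Euler's limit formula for `1 / Γ(z)`, with a rate that is uniform on the disc `‖z‖ ≤ A`. -/
theorem exists_norm_negBinomCoeff_mul_cpow_sub_le (A : ℝ) (hA : 0 ≤ A) :
    ∃ C : ℝ, 0 ≤ C ∧ (∀ z : ℂ, ‖z‖ ≤ A → ‖1 / Complex.Gamma z‖ ≤ C) ∧
      ∀ z : ℂ, ‖z‖ ≤ A → ∀ n : ℕ, 1 ≤ n →
        ‖negBinomCoeff z n * (n : ℂ) ^ (1 - z) - 1 / Complex.Gamma z‖ ≤ C / n := by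
  set K : ℝ := Real.exp A * (A + A ^ 2 * Real.exp A) with hK
  have hK0 : 0 ≤ K := by positivity
  set B : ℝ := A * Real.exp (2 * K) with hB
  have hB0 : 0 ≤ B := by positivity
  -- `1 / n ^ 2` is dominated by a telescoping difference
  have tele : ∀ n : ℕ, 1 ≤ n → (1 / (n : ℝ)) ^ 2 ≤ 2 * (1 / (n : ℝ) - 1 / ((n + 1 : ℕ) : ℝ)) := by
    intro n hn
    have hn' : (1 : ℝ) ≤ n := by exact_mod_cast hn
    push_cast
    rw [div_sub_div _ _ (by positivity) (by positivity), div_pow, ← mul_div_assoc,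
      div_le_div_iff₀ (by positivity) (by positivity)]
    nlinarith [mul_nonneg (sub_nonneg.2 hn') (by positivity : (0 : ℝ) ≤ n)]
  have bdd : ∀ z : ℂ, ‖z‖ ≤ A → ∀ n : ℕ, 1 ≤ n →
      ‖negBinomCoeff z n * (n : ℂ) ^ (1 - z)‖ ≤ A * Real.exp (2 * K * (1 - 1 / (n : ℝ))) := by
    intro z hz n hn
    induction n, hn using Nat.le_induction with
    | base => simpa [negBinomCoeff] using hz
    | succ n hn ih =>
      have h1 := norm_negBinomCoeff_mul_cpow_succ_sub_le hz hn
      have h2 := norm_le_norm_add_norm_sub' (negBinomCoeff z (n + 1) * ((n + 1 : ℕ) : ℂ) ^ (1 - z))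
        (negBinomCoeff z n * (n : ℂ) ^ (1 - z))
      rw [← hK] at h1
      calc _ ≤ (K * (1 / (n : ℝ)) ^ 2 + 1) * ‖negBinomCoeff z n * (n : ℂ) ^ (1 - z)‖ := by linarith
        _ ≤ Real.exp (K * (2 * (1 / (n : ℝ) - 1 / ((n + 1 : ℕ) : ℝ)))) *
            (A * Real.exp (2 * K * (1 - 1 / (n : ℝ)))) := by
          gcongr
          refine (Real.add_one_le_exp _).trans ?_
          gcongr
          exact tele n hn
        _ = _ := by
          rw [mul_left_comm, ← Real.exp_add]
          congr 2
          ring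
  have bddB : ∀ z : ℂ, ‖z‖ ≤ A → ∀ n : ℕ, 1 ≤ n →
      ‖negBinomCoeff z n * (n : ℂ) ^ (1 - z)‖ ≤ B := by
    intro z hz n hn
    refine (bdd z hz n hn).trans ?_
    have : 0 ≤ 1 / (n : ℝ) := by positivity
    refine mul_le_mul_of_nonneg_left (Real.exp_le_exp.2 ?_) hA
    nlinarith
  have cauchy : ∀ z : ℂ, ‖z‖ ≤ A → ∀ n : ℕ, 1 ≤ n → ∀ N, n ≤ N →
      ‖negBinomCoeff z n * (n : ℂ) ^ (1 - z) - negBinomCoeff z N * (N : ℂ) ^ (1 - z)‖ ≤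
        2 * K * B * (1 / (n : ℝ) - 1 / (N : ℝ)) := by
    intro z hz n hn N hN
    induction N, hN using Nat.le_induction with
    | base => simp
    | succ N hN ih =>
      have h1 := norm_negBinomCoeff_mul_cpow_succ_sub_le hz (hn.trans hN)
      have h2 := norm_sub_le_norm_sub_add_norm_sub (negBinomCoeff z n * (n : ℂ) ^ (1 - z))
        (negBinomCoeff z N * (N : ℂ) ^ (1 - z))
        (negBinomCoeff z (N + 1) * ((N + 1 : ℕ) : ℂ) ^ (1 - z))
      rw [norm_sub_rev, ← hK] at h1
      have h3 : K * (1 / (N : ℝ)) ^ 2 * ‖negBinomCoeff z N * (N : ℂ) ^ (1 - z)‖ ≤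
          K * (2 * (1 / (N : ℝ) - 1 / ((N + 1 : ℕ) : ℝ))) * B := by
        have := tele N (hn.trans hN)
        have h4 := bddB z hz N (hn.trans hN)
        have h5 : 0 ≤ (1 / (N : ℝ)) ^ 2 := by positivity
        gcongr
        exact mul_nonneg hK0 (h5.trans this)
      calc _ ≤ _ := h2
        _ ≤ 2 * K * B * (1 / (n : ℝ) - 1 / (N : ℝ)) +
            K * (2 * (1 / (N : ℝ) - 1 / ((N + 1 : ℕ) : ℝ))) * B := add_le_add ih (h1.trans h3)
        _ = _ := by ring
  refine ⟨B + 2 * K * B, by positivity, fun z hz => ?_, fun z hz n hn => ?_⟩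
  · refine le_trans ?_ (le_add_of_nonneg_right (by positivity : 0 ≤ 2 * K * B))
    refine le_of_tendsto (tendsto_negBinomCoeff_mul_cpow z).norm ?_
    filter_upwards [Filter.eventually_ge_atTop 1] with N hN using bddB z hz N hN
  · have h : ‖negBinomCoeff z n * (n : ℂ) ^ (1 - z) - 1 / Complex.Gamma z‖ ≤ 2 * K * B / n := by
      refine le_of_tendsto ((tendsto_negBinomCoeff_mul_cpow z).const_sub _).norm ?_
      filter_upwards [Filter.eventually_ge_atTop n] with N hN
      refine (cauchy z hz n hn N hN).trans ?_
      rw [div_eq_mul_one_div (2 * K * B)]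
      refine mul_le_mul_of_nonneg_left ?_ (by positivity)
      have : 0 ≤ 1 / (N : ℝ) := by positivity
      linarith
    exact h.trans (by gcongr; linarith)

/-! ### Power series with a prescribed logarithmic derivative -/

open Finset in
/-- If `g = exp L` formally, where `c` is the coefficient sequence of `L'`, then the coefficients of
`g` are bounded on a circle of radius `r` in terms of the `ℓ¹` norm of `c` there only. -/
theorem norm_mul_pow_le_of_recurrence {g c : ℕ → ℂ} {r : ℝ} {N : ℕ} (hr : 0 ≤ r) (hN : 1 ≤ N)
    (g0 : g 0 = 1)
    (hrec : ∀ k : ℕ, ((k : ℂ) + 1) * g (k + 1) = ∑ p ∈ antidiagonal k, c p.1 * g p.2)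
    (hc : ∀ k : ℕ, ∑ i ∈ range k, ‖c i‖ * r ^ (i + 1) ≤ N) (k : ℕ) :
    ‖g k‖ * r ^ k ≤ (N : ℝ) ^ N := by
  have hN' : (1 : ℝ) ≤ N := by exact_mod_cast hN
  -- each step `k ≤ N` costs a factor at most `N / k ≤ N`, each later step a factor `N / k ≤ 1`
  suffices h : ∀ k, ‖g k‖ * r ^ k ≤ (N : ℝ) ^ min k N from
    (h k).trans (pow_le_pow_right₀ hN' (min_le_right _ _))
  intro k
  induction k using Nat.strong_induction_on with
  | _ k ih =>
    rcases k with _ | k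
    · simp [g0]
    have h1 : ((k : ℝ) + 1) * (‖g (k + 1)‖ * r ^ (k + 1)) ≤ N * (N : ℝ) ^ min k N := by
      have h2 : ((k : ℝ) + 1) * ‖g (k + 1)‖ = ‖((k : ℂ) + 1) * g (k + 1)‖ := by
        rw [norm_mul]
        congr 1
        exact_mod_cast (Complex.norm_natCast (k + 1)).symm
      calc ((k : ℝ) + 1) * (‖g (k + 1)‖ * r ^ (k + 1))
          = ‖∑ p ∈ antidiagonal k, c p.1 * g p.2‖ * r ^ (k + 1) := by
            rw [← mul_assoc, h2, hrec]
        _ ≤ (∑ p ∈ antidiagonal k, ‖c p.1 * g p.2‖) * r ^ (k + 1) := by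
            gcongr
            exact norm_sum_le _ _
        _ = ∑ p ∈ antidiagonal k, (‖c p.1‖ * r ^ (p.1 + 1)) * (‖g p.2‖ * r ^ p.2) := by
            rw [sum_mul]
            refine sum_congr rfl fun p hp => ?_
            rw [norm_mul, ← mem_antidiagonal.1 hp]
            ring
        _ ≤ ∑ p ∈ antidiagonal k, (‖c p.1‖ * r ^ (p.1 + 1)) * (N : ℝ) ^ min k N := by
            refine sum_le_sum fun p hp => ?_
            have hp' := mem_antidiagonal.1 hp
            gcongr
            refine (ih p.2 (by omega)).trans (pow_le_pow_right₀ hN' ?_)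
            exact min_le_min_right _ (by omega)
        _ = (∑ i ∈ range (k + 1), ‖c i‖ * r ^ (i + 1)) * (N : ℝ) ^ min k N := by
            rw [← sum_mul, Finset.Nat.sum_antidiagonal_eq_sum_range_succ_mk]
        _ ≤ _ := by
            gcongr
            exact hc _
    have hk : (0 : ℝ) < (k : ℝ) + 1 := by positivity
    refine le_of_mul_le_mul_left (h1.trans ?_) hk
    rcases Nat.lt_or_ge k N with h | h
    · rw [min_eq_left h.le, min_eq_left (by omega : k + 1 ≤ N), ← pow_succ']
      exact le_mul_of_one_le_left (by positivity) (by linarith [(Nat.cast_nonneg k : (0 : ℝ) ≤ k)])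
    · rw [min_eq_right h, min_eq_right (by omega)]
      gcongr
      have : (N : ℝ) ≤ k := by exact_mod_cast h
      linarith

theorem summable_norm_mul_pow_of_bounded {a : ℕ → ℂ} {B r ρ : ℝ} (h : ∀ k, ‖a k‖ * r ^ k ≤ B)
    (hρ : 0 ≤ ρ) (hρr : ρ < r) (m : ℕ) : Summable fun k : ℕ => (k : ℝ) ^ m * (‖a k‖ * ρ ^ k) := by
  have hr : 0 < r := hρ.trans_lt hρr
  have h1 : Summable fun k : ℕ => B * ((k : ℝ) ^ m * (ρ / r) ^ k) := by
    refine (summable_pow_mul_geometric_of_norm_lt_one m ?_).mul_left B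
    rw [Real.norm_of_nonneg (by positivity), div_lt_one hr]
    exact hρr
  refine Summable.of_nonneg_of_le (fun k => by positivity) (fun k => ?_) h1
  have e : ‖a k‖ * ρ ^ k = ‖a k‖ * r ^ k * (ρ / r) ^ k := by
    rw [div_pow]
    field_simp
  rw [e, mul_left_comm]
  exact mul_le_mul_of_nonneg_right (h k) (by positivity)

theorem hasDerivAt_tsum_mul_pow {a : ℕ → ℂ} {B r : ℝ} (h : ∀ k, ‖a k‖ * r ^ k ≤ B) {u : ℂ}
    (hu : ‖u‖ < r) :
    HasDerivAt (fun w => ∑' k, a k * w ^ k) (∑' k : ℕ, ((k : ℂ) + 1) * a (k + 1) * u ^ k) u := by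
  obtain ⟨ρ, hρ1, hρ2⟩ := exists_between hu
  have hρ : 0 < ρ := (norm_nonneg u).trans_lt hρ1
  have hs : Summable fun k : ℕ => (k : ℝ) ^ 1 * (‖a k‖ * ρ ^ k) * ρ⁻¹ :=
    (summable_norm_mul_pow_of_bounded h hρ.le hρ2 1).mul_right _
  have hle : ∀ (n : ℕ) (y : ℂ), y ∈ Metric.ball (0 : ℂ) ρ →
      ‖a n * (n * y ^ (n - 1))‖ ≤ (n : ℝ) ^ 1 * (‖a n‖ * ρ ^ n) * ρ⁻¹ := by
    intro n y hy
    rcases n with _ | n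
    · simp
    have hy' : ‖y‖ ≤ ρ := by simpa using (Metric.mem_ball.1 hy).le
    rw [norm_mul, norm_mul, norm_pow, Complex.norm_natCast]
    calc _ ≤ ‖a (n + 1)‖ * (((n + 1 : ℕ) : ℝ) * ρ ^ n) := by
          simp only [Nat.add_sub_cancel]
          gcongr
      _ = _ := by
          rw [pow_succ ρ n]
          field_simp
  have key := hasDerivAt_tsum_of_isPreconnected (𝕜 := ℂ) (g := fun n w => a n * w ^ n)
    (g' := fun n w => a n * (n * w ^ (n - 1))) hs Metric.isOpen_ball
    (convex_ball (0 : ℂ) ρ).isPreconnected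
    (fun n y _ => (hasDerivAt_pow n y).const_mul (a n)) hle (Metric.mem_ball_self hρ)
    (summable_of_ne_finset_zero (s := {0}) (by
      intro b hb
      simp at hb
      simp [hb]))
    (show u ∈ Metric.ball (0 : ℂ) ρ by simpa using hρ1)
  have hsum : Summable fun n : ℕ => a n * (n * u ^ (n - 1)) :=
    Summable.of_norm_bounded hs fun n => hle n u (by simpa using hρ1)
  rw [hsum.tsum_eq_zero_add] at key
  refine key.congr_deriv ?_
  simp only [Nat.cast_zero, zero_mul, mul_zero, zero_add, Nat.add_sub_cancel]
  refine tsum_congr fun k => ?_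
  push_cast
  ring

open Finset in
/-- A power series with `g(0) = 1` and `g' = c g` is `exp (∫ c)` inside its disc of convergence. -/
theorem tsum_mul_pow_eq_exp_of_recurrence {g c : ℕ → ℂ} {B r : ℝ} (hr : 0 < r)
    (g0 : g 0 = 1)
    (hrec : ∀ k : ℕ, ((k : ℂ) + 1) * g (k + 1) = ∑ p ∈ antidiagonal k, c p.1 * g p.2)
    (hg : ∀ k, ‖g k‖ * r ^ k ≤ B) (hc : ∀ k : ℕ, ‖c k‖ * r ^ (k + 1) ≤ B) {u : ℂ} (hu : ‖u‖ < r) :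
    ∑' k, g k * u ^ k = Complex.exp (∑' k : ℕ, c k * u ^ (k + 1) / (k + 1)) := by
  have hB : 0 ≤ B := le_trans (by positivity) (hg 0)
  set l : ℕ → ℂ := fun k => if k = 0 then 0 else c (k - 1) / k with hl
  have hl0 : l 0 = 0 := by simp [hl]
  have hl1 : ∀ k : ℕ, l (k + 1) = c k / (k + 1) := fun k => by simp [hl]
  have hlB : ∀ k, ‖l k‖ * r ^ k ≤ B := by
    rintro (_ | k)
    · simpa [hl0] using hB
    · rw [hl1, norm_div]
      refine le_trans ?_ (hc k)
      gcongr
      refine div_le_self (norm_nonneg _) ?_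
      have : ‖((k : ℂ) + 1)‖ = (k : ℝ) + 1 := by exact_mod_cast Complex.norm_natCast (k + 1)
      rw [this]
      linarith [(Nat.cast_nonneg k : (0 : ℝ) ≤ k)]
  set G : ℂ → ℂ := fun w => ∑' k, g k * w ^ k with hG
  set L : ℂ → ℂ := fun w => ∑' k, l k * w ^ k with hL
  have hcB : ∀ k : ℕ, ‖c k‖ * r ^ k ≤ B / r := by
    intro k
    rw [le_div_iff₀ hr, mul_assoc, ← pow_succ]
    exact hc k
  have summ : ∀ {a : ℕ → ℂ} {B' : ℝ}, (∀ k, ‖a k‖ * r ^ k ≤ B') → ∀ w : ℂ, ‖w‖ < r →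
      Summable fun k => ‖a k * w ^ k‖ := by
    intro a B' ha w hw
    have := summable_norm_mul_pow_of_bounded ha (norm_nonneg w) hw 0
    simpa [norm_mul, norm_pow] using this
  have dL : ∀ w, ‖w‖ < r → HasDerivAt L (∑' k, c k * w ^ k) w := by
    intro w hw
    convert hasDerivAt_tsum_mul_pow hlB hw using 1
    refine tsum_congr fun k => ?_
    have : (k : ℂ) + 1 ≠ 0 := by exact_mod_cast k.succ_ne_zero
    rw [hl1]
    field_simp
  have dG : ∀ w, ‖w‖ < r → HasDerivAt G ((∑' k, c k * w ^ k) * G w) w := by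
    intro w hw
    convert hasDerivAt_tsum_mul_pow hg hw using 1
    rw [hG, tsum_mul_tsum_eq_tsum_sum_antidiagonal_of_summable_norm (summ hcB w hw) (summ hg w hw)]
    refine tsum_congr fun k => ?_
    rw [hrec, sum_mul]
    refine sum_congr rfl fun p hp => ?_
    rw [← mem_antidiagonal.1 hp]
    ring
  -- `g` and `exp L` solve the same linear differential equation, so their quotient is constant
  have dQ : ∀ w ∈ Metric.ball (0 : ℂ) r, HasDerivAt (fun w => G w * Complex.exp (-L w)) 0 w := by
    intro w hw
    have hw' : ‖w‖ < r := by simpa using hw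
    refine ((dG w hw').mul (dL w hw').neg.cexp).congr_deriv ?_
    simp only [Pi.neg_apply]
    ring
  have hconst := Metric.isOpen_ball.is_const_of_deriv_eq_zero
    (convex_ball (0 : ℂ) r).isPreconnected
    (fun w hw => (dQ w hw).differentiableAt.differentiableWithinAt)
    (fun w hw => (dQ w hw).deriv) (show u ∈ Metric.ball (0 : ℂ) r by simpa using hu)
    (Metric.mem_ball_self hr)
  have hG0 : G 0 = 1 := by
    rw [hG]
    simp only
    rw [tsum_eq_single 0 (by intro b hb; simp [hb])]
    simp [g0]
  have hL0 : L 0 = 0 := by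
    rw [hL]
    simp only
    rw [tsum_eq_single 0 (by intro b hb; simp [hb])]
    simp [hl0]
  have hLu : L u = ∑' k : ℕ, c k * u ^ (k + 1) / (k + 1) := by
    rw [hL]
    simp only
    rw [(summ hlB u hu).of_norm.tsum_eq_zero_add]
    simp only [hl0, zero_mul, zero_add, hl1]
    exact tsum_congr fun k => by ring
  simp only [hG0, hL0, neg_zero, Complex.exp_zero, mul_one] at hconst
  rw [← hLu]
  change G u = _
  rw [Complex.exp_neg] at hconst
  field_simp at hconst
  exact hconst

/-! ### Counting prime powers dividing monic polynomials -/

open Classical in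
/-- The monic irreducible polynomials of degree `d`. -/
noncomputable def monicIrreduciblesOfDegree (F : Type*) [Field F] [Fintype F] (d : ℕ) :
    Finset F[X] := (monicsOfDegree_finite F d).toFinset.filter Irreducible

/-- The power sum `∑_{p, j} deg p * z ^ j` over the prime powers `p ^ j` of degree `k`. It is the
coefficient of `u ^ k` in `u F'(u) / F(u)`, where `F(u) = ∑_f z ^ Ω(f) u ^ deg f`. -/
noncomputable def primePowerSum (F : Type*) [Field F] [Fintype F] (z : ℂ) (k : ℕ) : ℂ :=
  ∑ x ∈ k.divisorsAntidiagonal, ((x.1 * (monicIrreduciblesOfDegree F x.1).card : ℕ) : ℂ) * z ^ x.2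

section

variable {F : Type*} [Field F]

theorem bigOmega_irreducible_pow_mul {p g : F[X]} (hp : Irreducible p) (hg : g ≠ 0) (j : ℕ) :
    bigOmega (p ^ j * g) = j + bigOmega g := by
  classical
  unfold bigOmega
  rw [UniqueFactorizationMonoid.normalizedFactors_mul (pow_ne_zero _ hp.ne_zero) hg,
    UniqueFactorizationMonoid.normalizedFactors_pow,
    UniqueFactorizationMonoid.normalizedFactors_irreducible hp]
  simp

open Classical in
theorem pow_dvd_iff_le_count {p f : F[X]} (hp : Irreducible p) (hpm : p.Monic) (hf : f ≠ 0)
    (j : ℕ) :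
    p ^ j ∣ f ↔ j ≤ (UniqueFactorizationMonoid.normalizedFactors f).count p := by
  rw [UniqueFactorizationMonoid.dvd_iff_normalizedFactors_le_normalizedFactors
    (pow_ne_zero _ hp.ne_zero) hf, UniqueFactorizationMonoid.normalizedFactors_pow,
    UniqueFactorizationMonoid.normalizedFactors_irreducible hp, hpm.normalize_eq_self,
    Multiset.nsmul_singleton, Multiset.le_count_iff_replicate_le]

variable [Fintype F]

theorem mem_toFinset_monicsOfDegree {n : ℕ} {f : F[X]} :
    f ∈ (monicsOfDegree_finite F n).toFinset ↔ f.Monic ∧ f.natDegree = n := by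
  rw [Set.Finite.mem_toFinset]
  rfl

theorem mem_monicIrreduciblesOfDegree {d : ℕ} {p : F[X]} :
    p ∈ monicIrreduciblesOfDegree F d ↔ p.Monic ∧ p.natDegree = d ∧ Irreducible p := by
  classical
  rw [monicIrreduciblesOfDegree, Finset.mem_filter, mem_toFinset_monicsOfDegree, and_assoc]

theorem card_monicsOfDegree (n : ℕ) :
    (monicsOfDegree_finite F n).toFinset.card = Fintype.card F ^ n := by
  have e : monicsOfDegree F n ≃ (Fin n → F) :=
    (monicEquivDegreeLT n).trans (degreeLTEquiv F n).toEquiv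
  rw [← Set.ncard_eq_toFinset_card _ (monicsOfDegree_finite F n), ← Nat.card_coe_set_eq, Nat.card_congr e]
  simp

open Classical in
/-- The degree of `f` is the sum of `deg p` over all pairs `(p, j)` with `j ≥ 1` and `p ^ j ∣ f`. -/
theorem degree_eq_sum_prime_powers {n : ℕ} {f : F[X]} (hfm : f.Monic)
    (hfn : f.natDegree = n) :
    n = ∑ d ∈ Finset.Icc 1 n, ∑ p ∈ monicIrreduciblesOfDegree F d, ∑ j ∈ Finset.Icc 1 n,
      if p ^ j ∣ f then d else 0 := by
  set s := UniqueFactorizationMonoid.normalizedFactors f with hs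
  have hf0 := hfm.ne_zero
  have hprop : ∀ p ∈ s, p.Monic ∧ Irreducible p := fun p hp =>
    ⟨(Polynomial.normalize_eq_self_iff_monic
      (UniqueFactorizationMonoid.irreducible_of_normalized_factor p hp).ne_zero).1
      (UniqueFactorizationMonoid.normalize_normalized_factor p hp),
    UniqueFactorizationMonoid.irreducible_of_normalized_factor p hp⟩
  have hprod : s.prod = f := by
    rw [UniqueFactorizationMonoid.prod_normalizedFactors_eq hf0, hfm.normalize_eq_self]
  have hdeg : n = ∑ p ∈ s.toFinset, s.count p * p.natDegree := by
    rw [← hfn]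
    conv_lhs => rw [← hprod]
    rw [natDegree_multiset_prod_of_monic _ fun p hp => (hprop p hp).1,
      Finset.sum_multiset_map_count]
    simp
  have hcount : ∀ p : F[X], p.Monic → Irreducible p → s.count p ≤ n := by
    intro p hpm hp
    have h1 := (pow_dvd_iff_le_count hp hpm hf0 (s.count p)).2 le_rfl
    have h2 := natDegree_le_of_dvd h1 hf0
    rw [natDegree_pow, hfn] at h2
    exact (Nat.le_mul_of_pos_right _ hp.natDegree_pos).trans h2
  have hmaps : ∀ p ∈ s.toFinset, p.natDegree ∈ Finset.Icc 1 n := by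
    intro p hp
    rw [Multiset.mem_toFinset] at hp
    refine Finset.mem_Icc.2 ⟨(hprop p hp).2.natDegree_pos, ?_⟩
    rw [← hfn]
    exact natDegree_le_of_dvd (UniqueFactorizationMonoid.dvd_of_mem_normalizedFactors hp) hf0
  conv_lhs => rw [hdeg, ← Finset.sum_fiberwise_of_maps_to hmaps]
  refine Finset.sum_congr rfl fun d _ => ?_
  have hsub : s.toFinset.filter (fun p => p.natDegree = d) ⊆ monicIrreduciblesOfDegree F d := by
    intro p hp
    rw [Finset.mem_filter, Multiset.mem_toFinset] at hp
    exact mem_monicIrreduciblesOfDegree.2 ⟨(hprop p hp.1).1, hp.2, (hprop p hp.1).2⟩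
  rw [Finset.sum_subset hsub]
  · refine Finset.sum_congr rfl fun p hp => ?_
    obtain ⟨hpm, hpd, hpi⟩ := mem_monicIrreduciblesOfDegree.1 hp
    rw [← Finset.sum_filter, Finset.sum_const, smul_eq_mul, hpd]
    congr 1
    have : (Finset.Icc 1 n).filter (fun j => p ^ j ∣ f) = Finset.Icc 1 (s.count p) := by
      ext j
      have := hcount p hpm hpi
      rw [Finset.mem_filter, pow_dvd_iff_le_count hpi hpm hf0, ← hs, Finset.mem_Icc, Finset.mem_Icc]
      omega
    rw [this, Nat.card_Icc, Nat.add_sub_cancel]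
  · intro p hp hp'
    obtain ⟨hpm, hpd, hpi⟩ := mem_monicIrreduciblesOfDegree.1 hp
    rw [Finset.mem_filter, Multiset.mem_toFinset, not_and'] at hp'
    rw [Multiset.count_eq_zero_of_notMem (hp' hpd), zero_mul]

open Classical in
theorem sum_pow_bigOmega_of_pow_dvd (z : ℂ) {n d j : ℕ} {p : F[X]}
    (hp : p ∈ monicIrreduciblesOfDegree F d) :
    ∑ f ∈ (monicsOfDegree_finite F n).toFinset.filter (fun f => p ^ j ∣ f), z ^ bigOmega f =
      if d * j ≤ n then z ^ j * omegaSum F z (n - d * j) else 0 := by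
  obtain ⟨hpm, hpd, hpi⟩ := mem_monicIrreduciblesOfDegree.1 hp
  have hdeg : (p ^ j).natDegree = d * j := by rw [natDegree_pow, hpd, mul_comm]
  split_ifs with h
  · rw [omegaSum, Finset.mul_sum]
    symm
    refine Finset.sum_bij (fun g _ => p ^ j * g) ?_ ?_ ?_ ?_
    · intro g hg
      obtain ⟨hgm, hgd⟩ := mem_toFinset_monicsOfDegree.1 hg
      refine Finset.mem_filter.2 ⟨mem_toFinset_monicsOfDegree.2 ⟨(hpm.pow j).mul hgm, ?_⟩,
        dvd_mul_right _ _⟩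
      rw [(hpm.pow j).natDegree_mul hgm, hdeg, hgd]
      omega
    · intro g _ g' _ hgg
      exact mul_left_cancel₀ (pow_ne_zero _ hpi.ne_zero) hgg
    · intro f hf
      obtain ⟨hf, g, rfl⟩ := Finset.mem_filter.1 hf
      obtain ⟨hfm, hfd⟩ := mem_toFinset_monicsOfDegree.1 hf
      have hgm : g.Monic := (hpm.pow j).of_mul_monic_left hfm
      rw [(hpm.pow j).natDegree_mul hgm, hdeg] at hfd
      exact ⟨g, mem_toFinset_monicsOfDegree.2 ⟨hgm, by omega⟩, rfl⟩
    · intro g hg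
      rw [bigOmega_irreducible_pow_mul hpi (mem_toFinset_monicsOfDegree.1 hg).1.ne_zero, pow_add]
  · refine Finset.sum_eq_zero fun f hf => absurd ?_ h
    obtain ⟨hf, hdvd⟩ := Finset.mem_filter.1 hf
    obtain ⟨hfm, hfd⟩ := mem_toFinset_monicsOfDegree.1 hf
    rw [← hdeg, ← hfd]
    exact natDegree_le_of_dvd hdvd hfm.ne_zero

/-- Summation over pairs `(d, j)` with `d j ≤ n + 1`, rearranged according to the product. -/
theorem sum_Icc_ite_mul_le_eq_sum_divisorsAntidiagonal {M : Type*} [AddCommMonoid M] (n : ℕ)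
    (φ : ℕ → ℕ → M) :
    (∑ d ∈ Finset.Icc 1 (n + 1), ∑ j ∈ Finset.Icc 1 (n + 1), if d * j ≤ n + 1 then φ d j else 0) =
      ∑ k ∈ Finset.range (n + 1), ∑ x ∈ (k + 1).divisorsAntidiagonal, φ x.1 x.2 := by
  rw [← Finset.sum_product', ← Finset.sum_filter]
  have hpos : ∀ x ∈ (Finset.Icc 1 (n + 1) ×ˢ Finset.Icc 1 (n + 1)).filter
      (fun x : ℕ × ℕ => x.1 * x.2 ≤ n + 1), x.1 * x.2 - 1 ∈ Finset.range (n + 1) := by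
    intro x hx
    have := (Finset.mem_filter.1 hx).2
    exact Finset.mem_range.2 (by omega)
  rw [← Finset.sum_fiberwise_of_maps_to hpos]
  refine Finset.sum_congr rfl fun k hk => Finset.sum_congr ?_ fun _ _ => rfl
  rw [Finset.mem_range] at hk
  ext ⟨d, j⟩
  simp only [Finset.mem_filter, Finset.mem_product, Finset.mem_Icc, Nat.mem_divisorsAntidiagonal]
  constructor
  · rintro ⟨⟨⟨⟨h1, -⟩, h2, -⟩, -⟩, h⟩
    have : 0 < d * j := Nat.mul_pos h1 h2
    omega
  · rintro ⟨h, -⟩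
    have hd : 0 < d := Nat.pos_of_ne_zero (by rintro rfl; simp at h)
    have hj : 0 < j := Nat.pos_of_ne_zero (by rintro rfl; simp at h)
    have h1 : d ≤ d * j := Nat.le_mul_of_pos_right _ hj
    have h2 : j ≤ d * j := Nat.le_mul_of_pos_left _ hd
    omega

/-- Newton's identity for `n ↦ ∑_{deg f = n} z ^ Ω(f)`, from weighting each `f` by its degree. -/
theorem omegaSum_recurrence (z : ℂ) (n : ℕ) :
    ((n : ℂ) + 1) * omegaSum F z (n + 1) =
      ∑ p ∈ Finset.HasAntidiagonal.antidiagonal n, primePowerSum F z (p.1 + 1) * omegaSum F z p.2 := by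
  classical
  have h1 : ((n : ℂ) + 1) * omegaSum F z (n + 1) =
      ∑ d ∈ Finset.Icc 1 (n + 1), ∑ j ∈ Finset.Icc 1 (n + 1), if d * j ≤ n + 1 then
        ((d * (monicIrreduciblesOfDegree F d).card : ℕ) : ℂ) * z ^ j * omegaSum F z (n + 1 - d * j)
        else 0 := by
    calc ((n : ℂ) + 1) * omegaSum F z (n + 1)
        = ∑ f ∈ (monicsOfDegree_finite F (n + 1)).toFinset,
            ∑ d ∈ Finset.Icc 1 (n + 1), ∑ j ∈ Finset.Icc 1 (n + 1),
              ∑ p ∈ monicIrreduciblesOfDegree F d,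
              if p ^ j ∣ f then (d : ℂ) * z ^ bigOmega f else 0 := by
          rw [omegaSum, Finset.mul_sum]
          refine Finset.sum_congr rfl fun f hf => ?_
          obtain ⟨hfm, hfd⟩ := mem_toFinset_monicsOfDegree.1 hf
          have := congrArg (Nat.cast : ℕ → ℂ) (degree_eq_sum_prime_powers hfm hfd)
          push_cast at this
          rw [this, Finset.sum_mul]
          refine Finset.sum_congr rfl fun d _ => ?_
          rw [Finset.sum_comm, Finset.sum_mul]
          refine Finset.sum_congr rfl fun j _ => ?_
          rw [Finset.sum_mul]
          refine Finset.sum_congr rfl fun p _ => ?_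
          rw [ite_mul, zero_mul]
      _ = _ := by
          rw [Finset.sum_comm]
          refine Finset.sum_congr rfl fun d _ => ?_
          rw [Finset.sum_comm]
          refine Finset.sum_congr rfl fun j _ => ?_
          rw [Finset.sum_comm]
          have : ∀ p ∈ monicIrreduciblesOfDegree F d,
              (∑ f ∈ (monicsOfDegree_finite F (n + 1)).toFinset,
                if p ^ j ∣ f then (d : ℂ) * z ^ bigOmega f else 0) =
              if d * j ≤ n + 1 then (d : ℂ) * (z ^ j * omegaSum F z (n + 1 - d * j)) else 0 := by
            intro p hp
            rw [← Finset.sum_filter, ← Finset.mul_sum, sum_pow_bigOmega_of_pow_dvd z hp,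
              mul_ite, mul_zero]
          rw [Finset.sum_congr rfl this, Finset.sum_const, nsmul_eq_mul, mul_ite, mul_zero]
          refine if_congr Iff.rfl ?_ rfl
          push_cast
          ring
  rw [h1, sum_Icc_ite_mul_le_eq_sum_divisorsAntidiagonal n (fun d j =>
    ((d * (monicIrreduciblesOfDegree F d).card : ℕ) : ℂ) * z ^ j * omegaSum F z (n + 1 - d * j)),
    Finset.Nat.sum_antidiagonal_eq_sum_range_succ_mk]
  refine Finset.sum_congr rfl fun k _ => ?_
  rw [primePowerSum, Finset.sum_mul]
  refine Finset.sum_congr rfl fun x hx => ?_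
  rw [(Nat.mem_divisorsAntidiagonal.1 hx).1, Nat.add_sub_add_right]

theorem omegaSum_zero (z : ℂ) : omegaSum F z 0 = 1 := by
  have : (monicsOfDegree_finite F 0).toFinset = {1} := by
    ext f
    rw [mem_toFinset_monicsOfDegree, Finset.mem_singleton]
    exact ⟨fun h => h.1.natDegree_eq_zero.1 h.2, fun h => by simp [h]⟩
  rw [omegaSum, this]
  simp [bigOmega]

theorem omegaSum_one (n : ℕ) : omegaSum F 1 n = (Fintype.card F : ℂ) ^ n := by
  simp [omegaSum, card_monicsOfDegree]

theorem primePowerSum_one (k : ℕ) :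
    primePowerSum F 1 (k + 1) = (Fintype.card F : ℂ) ^ (k + 1) := by
  induction k using Nat.strong_induction_on with
  | _ k ih =>
    have h := omegaSum_recurrence (F := F) 1 k
    rw [Finset.Nat.sum_antidiagonal_eq_sum_range_succ_mk, Finset.sum_range_succ] at h
    simp only [omegaSum_one, Nat.sub_self, pow_zero, mul_one] at h
    have h2 : ∑ i ∈ Finset.range k, primePowerSum F 1 (i + 1) * (Fintype.card F : ℂ) ^ (k - i) =
        k * (Fintype.card F : ℂ) ^ (k + 1) := by
      rw [Finset.sum_congr rfl (g := fun _ => (Fintype.card F : ℂ) ^ (k + 1))]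
      · simp
      · intro i hi
        rw [Finset.mem_range] at hi
        rw [ih i hi, ← pow_add]
        congr 1
        omega
    rw [h2] at h
    linear_combination -h

/-- The prime polynomial theorem `∑_{d ∣ k} d π(d) = q ^ k`. -/
theorem sum_divisorsAntidiagonal_mul_card_monicIrreducibles (k : ℕ) :
    ∑ x ∈ (k + 1).divisorsAntidiagonal, x.1 * (monicIrreduciblesOfDegree F x.1).card =
      Fintype.card F ^ (k + 1) := by
  have := primePowerSum_one (F := F) k
  rw [primePowerSum] at this
  simp only [one_pow, mul_one] at this
  exact_mod_cast this

theorem mul_card_monicIrreducibles_le (d : ℕ) :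
    d * (monicIrreduciblesOfDegree F d).card ≤ Fintype.card F ^ d := by
  rcases d with _ | d
  · simp
  rw [← sum_divisorsAntidiagonal_mul_card_monicIrreducibles d]
  exact Finset.single_le_sum
    (f := fun x : ℕ × ℕ => x.1 * (monicIrreduciblesOfDegree F x.1).card)
    (fun _ _ => Nat.zero_le _)
    (show (d + 1, 1) ∈ (d + 1).divisorsAntidiagonal by simp)

theorem primePowerSum_sub (z : ℂ) (k : ℕ) :
    primePowerSum F z (k + 1) - z * (Fintype.card F : ℂ) ^ (k + 1) =
      ∑ x ∈ (k + 1).divisorsAntidiagonal,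
        ((x.1 * (monicIrreduciblesOfDegree F x.1).card : ℕ) : ℂ) * (z ^ x.2 - z) := by
  rw [← primePowerSum_one, primePowerSum, primePowerSum, Finset.mul_sum, ← Finset.sum_sub_distrib]
  refine Finset.sum_congr rfl fun x _ => ?_
  ring

end

/-! ### The Euler product -/

theorem sum_Icc_pow_le {x : ℝ} (hx0 : 0 ≤ x) (hx1 : x < 1) (n : ℕ) :
    ∑ i ∈ Finset.Icc 1 n, x ^ i ≤ (1 - x)⁻¹ := by
  rw [← tsum_geometric_of_lt_one hx0 hx1]
  exact (summable_geometric_of_lt_one hx0 hx1).sum_le_tsum _ fun _ _ => by positivity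

/-- Summation over pairs `(d, n)` of positive integers, rearranged according to the product. -/
theorem tsum_tsum_eq_tsum_sum_divisorsAntidiagonal {Φ : ℕ → ℕ → ℂ}
    (h : Summable fun x : ℕ × ℕ => Φ (x.1 + 1) (x.2 + 1)) :
    ∑' d : ℕ, ∑' n : ℕ, Φ (d + 1) (n + 1) =
      ∑' k : ℕ, ∑ x ∈ (k + 1).divisorsAntidiagonal, Φ x.1 x.2 := by
  let e : ℕ+ × ℕ+ ≃ ℕ × ℕ := Equiv.prodCongr Equiv.pnatEquivNat Equiv.pnatEquivNat
  have he : ∀ x : ℕ+ × ℕ+, Φ ((e x).1 + 1) ((e x).2 + 1) = Φ x.1 x.2 := by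
    intro x
    simp [e, Equiv.pnatEquivNat]
  have h1 : Summable fun x : ℕ+ × ℕ+ => Φ x.1 x.2 := by
    rw [← e.summable_iff] at h
    exact h.congr he
  have h2 : Summable fun c : Σ k : ℕ+, Nat.divisorsAntidiagonal k => Φ c.2.1.1 c.2.1.2 :=
    (sigmaAntidiagonalEquivProd.summable_iff.2 h1).congr fun _ => rfl
  have h3 : ∑' x : ℕ+ × ℕ+, Φ x.1 x.2 =
      ∑' c : Σ k : ℕ+, Nat.divisorsAntidiagonal k, Φ c.2.1.1 c.2.1.2 := by
    rw [← sigmaAntidiagonalEquivProd.tsum_eq]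
    rfl
  rw [← h.tsum_prod, ← e.tsum_eq, tsum_congr he, h3, h2.tsum_sigma,
    ← tsum_pnat_eq_tsum_succ (f := fun k => ∑ x ∈ k.divisorsAntidiagonal, Φ x.1 x.2)]
  refine tsum_congr fun k => ?_
  exact Finset.tsum_subtype (k : ℕ).divisorsAntidiagonal (fun x => Φ x.1 x.2)

/-- Summation over monic irreducibles of a quantity that depends on the degree only. -/
theorem hasSum_monicIrreducible_natDegree {F : Type*} [Field F] [Fintype F] {h : ℕ → ℂ}
    (hs : Summable fun d => ‖((monicIrreduciblesOfDegree F d).card : ℂ) * h d‖) :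
    HasSum (fun p : MonicIrreducible F => h p.1.natDegree)
      (∑' d, ((monicIrreduciblesOfDegree F d).card : ℂ) * h d) := by
  have fib : ∀ d, {p : MonicIrreducible F // p.1.natDegree = d} ≃
      monicIrreduciblesOfDegree F d := fun d =>
    { toFun := fun p => ⟨p.1.1, mem_monicIrreduciblesOfDegree.2 ⟨p.1.2.1, p.2, p.1.2.2⟩⟩
      invFun := fun p => ⟨⟨p.1, (mem_monicIrreduciblesOfDegree.1 p.2).1,
        (mem_monicIrreduciblesOfDegree.1 p.2).2.2⟩, (mem_monicIrreduciblesOfDegree.1 p.2).2.1⟩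
      left_inv := fun _ => rfl
      right_inv := fun _ => rfl }
  let e := Equiv.sigmaFiberEquiv (fun p : MonicIrreducible F => p.1.natDegree)
  let _ : ∀ d, Fintype {p : MonicIrreducible F // p.1.natDegree = d} := fun d =>
    Fintype.ofEquiv _ (fib d).symm
  have hcard : ∀ d, Fintype.card {p : MonicIrreducible F // p.1.natDegree = d} =
      (monicIrreduciblesOfDegree F d).card := fun d => by
    rw [Fintype.card_congr (fib d), Fintype.card_coe]
  have he : ∀ x, h (e x).1.natDegree = h x.1 := by
    rintro ⟨d, p, rfl⟩
    rfl
  have inner : ∀ d, HasSum (fun _ : {p : MonicIrreducible F // p.1.natDegree = d} => h d)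
      (((monicIrreduciblesOfDegree F d).card : ℂ) * h d) := by
    intro d
    convert! hasSum_fintype (fun _ : {p : MonicIrreducible F // p.1.natDegree = d} => h d) using 1
    rw [Finset.sum_const, Finset.card_univ, hcard, nsmul_eq_mul]
  have hsum : Summable fun x : Σ d, {p : MonicIrreducible F // p.1.natDegree = d} => h x.1 := by
    refine Summable.of_norm ((summable_sigma_of_nonneg fun _ => norm_nonneg _).2
      ⟨fun d => (hasSum_fintype _).summable, ?_⟩)
    refine hs.congr fun d => ?_
    rw [tsum_fintype]
    change _ = ∑ _b : {p : MonicIrreducible F // p.1.natDegree = d}, ‖h d‖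
    rw [Finset.sum_const, Finset.card_univ, hcard, nsmul_eq_mul, norm_mul, Complex.norm_natCast]
  rw [← e.hasSum_iff]
  have h3 := hsum.hasSum
  have h4 : ∑' x : Σ d, {p : MonicIrreducible F // p.1.natDegree = d}, h x.1 =
      ∑' d, ((monicIrreduciblesOfDegree F d).card : ℂ) * h d := by
    rw [hsum.tsum_sigma]
    exact tsum_congr fun d => (inner d).tsum_eq
  rw [h4] at h3
  convert! h3 using 1
  exact funext he

section

variable {F : Type*} [Field F] [Fintype F]

/-- The contribution of the powers `p ^ j` with `j ≥ 2` is dominated by a product of two geometric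
progressions; the factors with `j = 1` cancel. -/
theorem norm_mul_card_monicIrreducibles_mul_pow_sub_le {A r : ℝ} (hA : 1 ≤ A) (hr0 : 0 < r)
    (hr1 : r ≤ 1) {z : ℂ} (hz : ‖z‖ ≤ A) {d j : ℕ} (hd : 1 ≤ d) (hj : 1 ≤ j) :
    ‖((d * (monicIrreduciblesOfDegree F d).card : ℕ) : ℂ) * (z ^ j - z)‖ * r ^ (d * j) ≤
      2 / r ^ 2 * (((Fintype.card F : ℝ) * r ^ 2) ^ d * (A * r) ^ j) := by
  rcases hj.eq_or_lt with rfl | hj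
  · simp only [pow_one, sub_self, mul_zero, norm_zero, zero_mul]
    positivity
  have h1 : ‖z ^ j - z‖ ≤ 2 * A ^ j := by
    have h2 : ‖z ^ j‖ ≤ A ^ j := by
      rw [norm_pow]
      gcongr
    have h3 : ‖z‖ ≤ A ^ j := hz.trans (le_self_pow₀ hA (by omega))
    linarith [norm_sub_le (z ^ j) z]
  have h2 : ((d * (monicIrreduciblesOfDegree F d).card : ℕ) : ℝ) ≤ (Fintype.card F : ℝ) ^ d := by
    exact_mod_cast mul_card_monicIrreducibles_le d
  -- `d j ≥ 2 d + j - 2` because `(d - 1) (j - 2) ≥ 0`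
  have h3 : r ^ (d * j) * r ^ 2 ≤ r ^ (2 * d + j) := by
    rw [← pow_add]
    refine pow_le_pow_of_le_one hr0.le hr1 ?_
    obtain ⟨a, rfl⟩ := Nat.exists_eq_add_of_le hd
    obtain ⟨b, rfl⟩ := Nat.exists_eq_add_of_le hj
    nlinarith [Nat.zero_le (a * b)]
  rw [norm_mul, Complex.norm_natCast]
  calc _ ≤ (Fintype.card F : ℝ) ^ d * (2 * A ^ j) * r ^ (d * j) := by gcongr
    _ = 2 / r ^ 2 * ((Fintype.card F : ℝ) ^ d * A ^ j) * (r ^ (d * j) * r ^ 2) := by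
        field_simp
    _ ≤ 2 / r ^ 2 * ((Fintype.card F : ℝ) ^ d * A ^ j) * r ^ (2 * d + j) := by gcongr
    _ = _ := by
        rw [mul_pow, mul_pow, pow_add, pow_mul]
        ring

/-- The logarithmic derivatives of `F(u)` and `(1 - q u) ^ (-z)` differ by a series that converges
absolutely on a circle of radius larger than `1 / q`, uniformly in `‖z‖ ≤ A < q`. -/
theorem sum_norm_primePowerSum_sub_mul_pow_le {A r : ℝ} (hA : 1 ≤ A) (hr0 : 0 < r) (hr1 : r ≤ 1)
    (hqr : (Fintype.card F : ℝ) * r ^ 2 < 1) (hAr : A * r < 1) {z : ℂ} (hz : ‖z‖ ≤ A) (N : ℕ) :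
    ∑ k ∈ Finset.range N, ‖primePowerSum F z (k + 1) - z * (Fintype.card F : ℂ) ^ (k + 1)‖ *
      r ^ (k + 1) ≤ 2 / r ^ 2 * ((1 - (Fintype.card F : ℝ) * r ^ 2)⁻¹ * (1 - A * r)⁻¹) := by
  have hAr0 : 0 ≤ A * r := by positivity
  have hqr0 : 0 ≤ (Fintype.card F : ℝ) * r ^ 2 := by positivity
  rcases N with _ | N
  · have := sub_pos.2 hqr
    have := sub_pos.2 hAr
    simp only [Finset.range_zero, Finset.sum_empty]
    positivity
  set β : ℕ → ℕ → ℝ := fun d j => 2 / r ^ 2 * (((Fintype.card F : ℝ) * r ^ 2) ^ d * (A * r) ^ j)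
    with hβ
  have hβ0 : ∀ d j, 0 ≤ β d j := fun d j => by rw [hβ]; positivity
  calc _ ≤ ∑ k ∈ Finset.range (N + 1), ∑ x ∈ (k + 1).divisorsAntidiagonal, β x.1 x.2 := by
        refine Finset.sum_le_sum fun k _ => ?_
        rw [primePowerSum_sub]
        refine (mul_le_mul_of_nonneg_right (norm_sum_le _ _) (by positivity)).trans ?_
        rw [Finset.sum_mul]
        refine Finset.sum_le_sum fun x hx => ?_
        have hx' := (Nat.mem_divisorsAntidiagonal.1 hx).1
        rw [← hx']
        refine norm_mul_card_monicIrreducibles_mul_pow_sub_le hA hr0 hr1 hz ?_ ?_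
        · exact Nat.pos_of_ne_zero (by intro h; simp [h] at hx')
        · exact Nat.pos_of_ne_zero (by intro h; simp [h] at hx')
    _ = ∑ d ∈ Finset.Icc 1 (N + 1), ∑ j ∈ Finset.Icc 1 (N + 1),
          if d * j ≤ N + 1 then β d j else 0 :=
        (sum_Icc_ite_mul_le_eq_sum_divisorsAntidiagonal N β).symm
    _ ≤ ∑ d ∈ Finset.Icc 1 (N + 1), ∑ j ∈ Finset.Icc 1 (N + 1), β d j := by
        refine Finset.sum_le_sum fun d _ => Finset.sum_le_sum fun j _ => ?_
        split_ifs
        · exact le_rfl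
        · exact hβ0 d j
    _ = 2 / r ^ 2 * ((∑ d ∈ Finset.Icc 1 (N + 1), ((Fintype.card F : ℝ) * r ^ 2) ^ d) *
          ∑ j ∈ Finset.Icc 1 (N + 1), (A * r) ^ j) := by
        rw [Finset.sum_mul_sum, Finset.mul_sum]
        exact Finset.sum_congr rfl fun d _ => by rw [Finset.mul_sum]
    _ ≤ _ := by
        have := sub_pos.2 hqr
        gcongr
        · exact sum_Icc_pow_le hqr0 hqr _
        · exact sum_Icc_pow_le hAr0 hAr _

theorem one_lt_card_real : (1 : ℝ) < Fintype.card F := by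
  exact_mod_cast Fintype.one_lt_card

/-- The Euler product is the exponential of the series of `(b_k - z q ^ k) q ^ (-k) / k`, where
`b_k` is the power sum over prime powers of degree `k`. -/
theorem hasProd_eulerFactor {z : ℂ} (hz : ‖z‖ < (Fintype.card F : ℝ)) :
    HasProd (eulerFactor F z) (Complex.exp (∑' k : ℕ,
      (primePowerSum F z (k + 1) - z * (Fintype.card F : ℂ) ^ (k + 1)) *
        (1 / (Fintype.card F : ℂ)) ^ (k + 1) / (k + 1))) := by
  set q : ℝ := (Fintype.card F : ℝ) with hq
  have hq1 : 1 < q := one_lt_card_real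
  have hqC : (Fintype.card F : ℂ) = (q : ℂ) := by simp [hq]
  have hq0 : (q : ℂ) ≠ 0 := by exact_mod_cast (by linarith : q ≠ 0)
  rw [hqC]
  set A : ℝ := max 1 ‖z‖ with hAdef
  have hA1 : 1 ≤ A := le_max_left _ _
  have hzA : ‖z‖ ≤ A := le_max_right _ _
  have hAq : A < q := max_lt hq1 hz
  set π : ℕ → ℂ := fun d => ((monicIrreduciblesOfDegree F d).card : ℂ) with hπ
  have hπ0 : π 0 = 0 := by
    have : monicIrreduciblesOfDegree F 0 = ∅ := by
      refine Finset.eq_empty_of_forall_notMem fun p hp => ?_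
      obtain ⟨-, h2, h3⟩ := mem_monicIrreduciblesOfDegree.1 hp
      have := h3.natDegree_pos
      omega
    rw [hπ]
    simp [this]
  set ψ : ℕ → ℕ → ℂ := fun d n => (z ^ n - z) / n * (1 / (q : ℂ)) ^ (d * n) with hψ
  set lam : ℕ → ℂ := fun d => z * Complex.log (1 - 1 / (q : ℂ) ^ d) -
    Complex.log (1 - z / (q : ℂ) ^ d) with hlam
  have hinv : ∀ d : ℕ, 1 ≤ d → ‖1 / (q : ℂ) ^ d‖ < 1 ∧ ‖z / (q : ℂ) ^ d‖ < 1 := by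
    intro d hd
    have h1 : q ≤ q ^ d := le_self_pow₀ hq1.le (by omega)
    rw [norm_div, norm_div, norm_pow, Complex.norm_real, Real.norm_of_nonneg (by linarith),
      norm_one, div_lt_one (by positivity), div_lt_one (by positivity)]
    exact ⟨by linarith, by linarith⟩
  have hlamsum : ∀ d : ℕ, HasSum (fun n : ℕ => ψ (d + 1) (n + 1)) (lam (d + 1)) := by
    intro d
    obtain ⟨h1, h2⟩ := hinv (d + 1) (by omega)
    have h3 := ((Complex.hasSum_taylorSeries_neg_log h2).sub
      ((Complex.hasSum_taylorSeries_neg_log h1).mul_left z))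
    rw [← hasSum_nat_add_iff' 1] at h3
    simp only [Finset.sum_range_one, Nat.cast_zero, div_zero, mul_zero, sub_zero] at h3
    convert! h3 using 1
    · ext n
      rw [hψ]
      simp only
      rw [div_pow, div_pow, ← pow_mul, div_pow, one_pow]
      ring
    · rw [hlam]
      ring
  have hsumm : Summable fun x : ℕ × ℕ => ‖π (x.1 + 1) * ψ (x.1 + 1) (x.2 + 1)‖ := by
    have hb : Summable fun x : ℕ × ℕ => 2 / (1 / q) ^ 2 *
        ((q * (1 / q) ^ 2) ^ (x.1 + 1) * (A * (1 / q)) ^ (x.2 + 1)) := by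
      refine Summable.mul_left _ ?_
      have g1 : Summable fun n : ℕ => (q * (1 / q) ^ 2) ^ (n + 1) := by
        refine (summable_nat_add_iff 1).2 (summable_geometric_of_lt_one (by positivity) ?_)
        have : q * (1 / q) ^ 2 = 1 / q := by field_simp
        rw [this, div_lt_one (by linarith)]
        exact hq1
      have g2 : Summable fun n : ℕ => (A * (1 / q)) ^ (n + 1) := by
        refine (summable_nat_add_iff 1).2 (summable_geometric_of_lt_one (by positivity) ?_)
        rw [mul_one_div, div_lt_one (by linarith)]
        exact hAq
      have g3 := g1.mul_of_nonneg g2 (fun n => by positivity) (fun n => by positivity)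
      exact g3
    -- the general bound for radius `r`, taken at `r = 1 / q`
    refine Summable.of_nonneg_of_le (fun _ => norm_nonneg _) (fun x => ?_) hb
    refine le_trans ?_ (norm_mul_card_monicIrreducibles_mul_pow_sub_le (F := F) hA1
      (show 0 < 1 / q by positivity) (by rw [div_le_one (by linarith)]; exact hq1.le) hzA
      (show 1 ≤ x.1 + 1 by omega) (show 1 ≤ x.2 + 1 by omega))
    rw [hπ, hψ]
    simp only
    rw [← mul_assoc, norm_mul, norm_pow, norm_div, norm_one, Complex.norm_real,
      Real.norm_of_nonneg (by linarith : 0 ≤ q)]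
    refine mul_le_mul_of_nonneg_right ?_ (by positivity)
    rw [norm_mul, norm_mul, norm_div, Complex.norm_natCast, Complex.norm_natCast,
      Complex.norm_natCast]
    refine mul_le_mul ?_ ?_ (by positivity) (by positivity)
    · exact_mod_cast Nat.le_mul_of_pos_left _ (Nat.succ_pos _)
    · refine div_le_self (norm_nonneg _) ?_
      exact_mod_cast Nat.succ_pos _
  have htsum : ∀ d : ℕ, ∑' n : ℕ, π (d + 1) * ψ (d + 1) (n + 1) = π (d + 1) * lam (d + 1) :=
    fun d => ((hlamsum d).mul_left _).tsum_eq
  have hnorm : Summable fun d : ℕ => ‖π d * lam d‖ := by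
    rw [← summable_nat_add_iff 1]
    refine Summable.of_nonneg_of_le (fun _ => norm_nonneg _) (fun d => ?_) hsumm.prod
    rw [← htsum]
    have h1 : Summable fun n : ℕ => ‖π (d + 1) * ψ (d + 1) (n + 1)‖ := hsumm.prod_factor d
    exact norm_tsum_le_tsum_norm h1
  have hS := hasSum_monicIrreducible_natDegree (F := F) (h := lam) hnorm
  have hval : ∑' d, π d * lam d = ∑' k : ℕ,
      (primePowerSum F z (k + 1) - z * (q : ℂ) ^ (k + 1)) * (1 / (q : ℂ)) ^ (k + 1) / (k + 1) := by
    rw [hnorm.of_norm.tsum_eq_zero_add, hπ0, zero_mul, zero_add, ← tsum_congr htsum,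
      tsum_tsum_eq_tsum_sum_divisorsAntidiagonal (Φ := fun d n => π d * ψ d n) hsumm.of_norm]
    refine tsum_congr fun k => ?_
    rw [← hqC, primePowerSum_sub, hqC, Finset.sum_mul, Finset.sum_div]
    refine Finset.sum_congr rfl fun x hx => ?_
    have hx' := (Nat.mem_divisorsAntidiagonal.1 hx).1
    have hx1 : (x.1 : ℂ) ≠ 0 := by
      intro h
      have : x.1 = 0 := by exact_mod_cast h
      simp [this] at hx'
    have hx2 : (x.2 : ℂ) ≠ 0 := by
      intro h
      have : x.2 = 0 := by exact_mod_cast h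
      simp [this] at hx'
    have hk : ((k : ℂ) + 1) = x.1 * x.2 := by exact_mod_cast hx'.symm
    rw [hψ, hπ, hk, ← hx']
    simp only
    push_cast
    field_simp
  change HasSum _ (∑' d, π d * lam d) at hS
  rw [← hval]
  have hP := hS.cexp
  convert! hP using 1
  ext p
  obtain ⟨h1, h2⟩ := hinv p.1.natDegree p.2.2.natDegree_pos
  have ne : ∀ w : ℂ, ‖w‖ < 1 → 1 - w ≠ 0 := by
    intro w hw h
    rw [← sub_eq_zero.1 h, norm_one] at hw
    exact lt_irrefl _ hw
  simp only [Function.comp_apply, hlam]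
  rw [eulerFactor, hqC, Complex.cpow_def_of_ne_zero (ne _ h1), Complex.exp_sub,
    Complex.exp_log (ne _ h2), mul_comm z]
  exact (div_eq_mul_inv _ _).symm

end

/-! ### Factorisation of the generating function and the asymptotic formula -/

open Finset in
theorem negBinomCoeff_recurrence (z q : ℂ) (k : ℕ) :
    ((k : ℂ) + 1) * (negBinomCoeff z (k + 1) * q ^ (k + 1)) =
      ∑ p ∈ HasAntidiagonal.antidiagonal k, (z * q ^ (p.1 + 1)) * (negBinomCoeff z p.2 * q ^ p.2) := by
  have h1 : ∀ k : ℕ, ((k : ℂ) + 1) * negBinomCoeff z (k + 1) =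
      z * ∑ j ∈ range (k + 1), negBinomCoeff z j := by
    intro k
    induction k with
    | zero => simp [negBinomCoeff]
    | succ k ih =>
      rw [sum_range_succ, mul_add, ← ih, negBinomCoeff_succ z (k + 1)]
      have : ((k + 1 : ℕ) : ℂ) + 1 ≠ 0 := by exact_mod_cast (k + 1).succ_ne_zero
      field_simp
      push_cast
      ring
  have h2 : ∀ p ∈ HasAntidiagonal.antidiagonal k,
      (z * q ^ (p.1 + 1)) * (negBinomCoeff z p.2 * q ^ p.2) =
        z * q ^ (k + 1) * negBinomCoeff z p.2 := by
    intro p hp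
    rw [← mem_antidiagonal.1 hp]
    ring
  rw [sum_congr rfl h2, ← mul_sum, ← Finset.Nat.sum_antidiagonal_swap,
    Finset.Nat.sum_antidiagonal_eq_sum_range_succ_mk, ← mul_assoc, h1]
  simp only [Prod.swap]
  ring

/-- The coefficient recurrence `(k + 1) f_{k+1} = ∑ c_i f_{k-i}` is the differential equation
`f' = c f`. -/
theorem derivative_mk_eq_mul_iff (f c : ℕ → ℂ) :
    PowerSeries.derivative ℂ (PowerSeries.mk f) = PowerSeries.mk c * PowerSeries.mk f ↔
      ∀ k : ℕ, ((k : ℂ) + 1) * f (k + 1) =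
        ∑ p ∈ Finset.HasAntidiagonal.antidiagonal k, c p.1 * f p.2 := by
  rw [PowerSeries.ext_iff]
  refine forall_congr' fun k => ?_
  rw [PowerSeries.coeff_derivative, PowerSeries.coeff_mul, PowerSeries.coeff_mk, mul_comm]
  simp only [PowerSeries.coeff_mk]

/-- Formal factorisation `F(u) = (1 - q u) ^ (-z) G(u)` with `G' = c G`, where `c` is the difference
of the two logarithmic derivatives. -/
theorem exists_omegaSum_eq_conv (F : Type*) [Field F] [Fintype F] (z : ℂ) :
    ∃ g : ℕ → ℂ, g 0 = 1 ∧
      (∀ k : ℕ, ((k : ℂ) + 1) * g (k + 1) = ∑ p ∈ Finset.HasAntidiagonal.antidiagonal k,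
        (primePowerSum F z (p.1 + 1) - z * (Fintype.card F : ℂ) ^ (p.1 + 1)) * g p.2) ∧
      ∀ n : ℕ, omegaSum F z n = ∑ k ∈ Finset.range (n + 1),
        g k * (negBinomCoeff z (n - k) * (Fintype.card F : ℂ) ^ (n - k)) := by
  set q : ℂ := (Fintype.card F : ℂ)
  set M : PowerSeries ℂ := PowerSeries.mk (omegaSum F z)
  set D : ℂ → PowerSeries ℂ := fun w => PowerSeries.mk fun k => negBinomCoeff w k * q ^ k with hD
  set Q : PowerSeries ℂ := PowerSeries.mk fun k => q ^ (k + 1) with hQ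
  set B : PowerSeries ℂ := PowerSeries.mk fun k => primePowerSum F z (k + 1) with hB
  have dM : PowerSeries.derivative ℂ M = B * M :=
    (derivative_mk_eq_mul_iff _ _).2 (omegaSum_recurrence z)
  have hwQ : ∀ w : ℂ, PowerSeries.mk (fun k => w * q ^ (k + 1)) = PowerSeries.C w * Q := by
    intro w
    ext k
    simp [hQ]
  have dD : ∀ w, PowerSeries.derivative ℂ (D w) = PowerSeries.C w * Q * D w := fun w => by
    rw [← hwQ]
    exact (derivative_mk_eq_mul_iff _ _).2 (negBinomCoeff_recurrence w q)
  have D0 : ∀ w, PowerSeries.constantCoeff (D w) = 1 := fun w => by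
    rw [← PowerSeries.coeff_zero_eq_constantCoeff_apply]
    simp [hD, negBinomCoeff_zero]
  have hDD : D z * D (-z) = 1 := by
    refine PowerSeries.derivative.ext ?_ (by simp [D0])
    rw [Derivation.leibniz, dD, dD, PowerSeries.derivative_one, map_neg, smul_eq_mul, smul_eq_mul]
    ring
  set G : PowerSeries ℂ := M * D (-z) with hG
  have hGmk : PowerSeries.mk (fun k => PowerSeries.coeff k G) = G := by
    ext k
    simp
  refine ⟨fun k => PowerSeries.coeff k G, ?_, ?_, fun n => ?_⟩
  · change PowerSeries.coeff 0 G = 1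
    rw [PowerSeries.coeff_zero_eq_constantCoeff_apply, hG, map_mul, D0, mul_one,
      ← PowerSeries.coeff_zero_eq_constantCoeff_apply, PowerSeries.coeff_mk, omegaSum_zero]
  · rw [← derivative_mk_eq_mul_iff (fun k => PowerSeries.coeff k G)
      (fun k => primePowerSum F z (k + 1) - z * q ^ (k + 1)), hGmk]
    have hc : PowerSeries.mk (fun k => primePowerSum F z (k + 1) - z * q ^ (k + 1)) =
        B - PowerSeries.C z * Q := by
      rw [← hwQ, hB]
      ext k
      simp
    rw [hc, hG, Derivation.leibniz, dD, dM, map_neg, smul_eq_mul, smul_eq_mul]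
    ring
  · have hM : M = G * D z := by
      rw [hG, mul_assoc, mul_comm (D (-z)), hDD, mul_one]
    have h1 : omegaSum F z n = PowerSeries.coeff n M := by rw [PowerSeries.coeff_mk]
    rw [h1, hM, PowerSeries.coeff_mul, Finset.Nat.sum_antidiagonal_eq_sum_range_succ_mk]
    simp only [hD, PowerSeries.coeff_mk]

/-- A shift of `n` by `k` changes `negBinomCoeff z n * n ^ (1 - z)` by at most a power of `1 + k`
divided by `n`. -/
theorem exists_norm_shifted_negBinomCoeff_sub_le (A : ℝ) (hA : 0 ≤ A) :
    ∃ (C : ℝ) (S : ℕ), 0 ≤ C ∧ ∀ z : ℂ, ‖z‖ ≤ A → ∀ n : ℕ, 1 ≤ n → ∀ k : ℕ,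
      ‖(if k ≤ n then negBinomCoeff z (n - k) * (n : ℂ) ^ (1 - z) else 0) - 1 / Complex.Gamma z‖ ≤
        C * ((k : ℝ) + 1) ^ S / n := by
  obtain ⟨C, hC0, hCG, hC⟩ := exists_norm_negBinomCoeff_mul_cpow_sub_le A hA
  obtain ⟨S, hS⟩ := exists_nat_ge (1 + A)
  have hS0 : (0 : ℝ) ≤ S := S.cast_nonneg
  refine ⟨1 + C + C * S, S + 2, by positivity, fun z hz n hn k => ?_⟩
  have hn0 : (0 : ℝ) < n := by exact_mod_cast hn
  have hk1 : (1 : ℝ) ≤ (k : ℝ) + 1 := by linarith [(Nat.cast_nonneg k : (0 : ℝ) ≤ k)]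
  have hw : ‖1 - z‖ ≤ S := by
    refine (norm_sub_le _ _).trans ?_
    rw [norm_one]
    linarith
  have hCS : 0 ≤ C * S := by positivity
  rcases lt_trichotomy k n with hkn | hkn | hkn
  · obtain ⟨m, rfl⟩ : ∃ m, n = k + m := ⟨n - k, by omega⟩
    have hm1 : 1 ≤ m := by omega
    have hm0 : (0 : ℝ) < m := by exact_mod_cast hm1
    have hm1' : (1 : ℝ) ≤ m := by exact_mod_cast hm1
    rw [if_pos hkn.le, Nat.add_sub_cancel_left]
    push_cast at hn0 ⊢
    have hk0 : (0 : ℝ) ≤ k := k.cast_nonneg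
    set v : ℝ := Real.log (((k : ℝ) + m) / m) with hv
    have hratio : ((k : ℝ) + m) / m ≤ k + 1 := by
      rw [div_le_iff₀ hm0]
      nlinarith
    have hratio1 : 1 ≤ ((k : ℝ) + m) / m := by
      rw [one_le_div hm0]
      linarith
    have hv0 : 0 ≤ v := Real.log_nonneg hratio1
    have hinv : 1 / (m : ℝ) ≤ (k + 1) / (k + m) := by
      rw [div_le_div_iff₀ hm0 hn0]
      nlinarith
    have hv1 : v ≤ (k + 1) * ((k + 1) / (k + m)) := by
      have h1 := Real.log_le_sub_one_of_pos (show 0 < ((k : ℝ) + m) / m by positivity)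
      have h2 : ((k : ℝ) + m) / m - 1 = k * (1 / m) := by
        field_simp
        ring
      rw [h2] at h1
      refine h1.trans ?_
      gcongr
      linarith
    have hexp : Real.exp (S * v) ≤ ((k : ℝ) + 1) ^ S := by
      rw [Real.exp_nat_mul, hv, Real.exp_log (by positivity)]
      gcongr
    have hwv : ‖(1 - z) * (v : ℂ)‖ ≤ S * v := by
      rw [norm_mul, Complex.norm_real, Real.norm_of_nonneg hv0]
      gcongr
    have hpow : ((k : ℂ) + m) ^ (1 - z) = (m : ℂ) ^ (1 - z) * Complex.exp ((1 - z) * v) := by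
      have h1 := natCast_cpow_eq_exp_log (show 1 ≤ k + m by omega) (1 - z)
      push_cast at h1
      rw [h1, natCast_cpow_eq_exp_log hm1, ← Complex.exp_add]
      congr 1
      have : Real.log ((k : ℝ) + m) = Real.log m + v := by
        rw [hv, Real.log_div hn0.ne' hm0.ne']
        ring
      rw [this]
      push_cast
      ring
    have hE1 : ‖Complex.exp ((1 - z) * v)‖ ≤ ((k : ℝ) + 1) ^ S :=
      (Complex.norm_exp_le_exp_norm _).trans ((Real.exp_le_exp.2 hwv).trans hexp)
    have hE2 : ‖Complex.exp ((1 - z) * v) - 1‖ ≤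
        S * ((k + 1) * ((k + 1) / (k + m))) * ((k : ℝ) + 1) ^ S := by
      have h1 := Complex.norm_exp_sub_sum_le_norm_mul_exp ((1 - z) * v) 1
      simp only [Finset.sum_range_one, pow_zero, Nat.factorial, Nat.cast_one, div_one,
        pow_one] at h1
      refine h1.trans ?_
      have h2 : Real.exp ‖(1 - z) * (v : ℂ)‖ ≤ ((k : ℝ) + 1) ^ S :=
        (Real.exp_le_exp.2 hwv).trans hexp
      have h3 : ‖(1 - z) * (v : ℂ)‖ ≤ S * ((k + 1) * ((k + 1) / (k + m))) :=
        hwv.trans (by gcongr)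
      gcongr
    have hsplit : negBinomCoeff z m * ((k : ℂ) + m) ^ (1 - z) - 1 / Complex.Gamma z =
        (negBinomCoeff z m * (m : ℂ) ^ (1 - z) - 1 / Complex.Gamma z) *
          Complex.exp ((1 - z) * v) +
        1 / Complex.Gamma z * (Complex.exp ((1 - z) * v) - 1) := by
      rw [hpow]
      ring
    rw [hsplit]
    calc _ ≤ C * ((k + 1) / (k + m)) * ((k : ℝ) + 1) ^ S +
          C * (S * ((k + 1) * ((k + 1) / (k + m))) * ((k : ℝ) + 1) ^ S) := by
          refine (norm_add_le _ _).trans ?_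
          rw [norm_mul, norm_mul (1 / Complex.Gamma z)]
          have h1 : ‖negBinomCoeff z m * (m : ℂ) ^ (1 - z) - 1 / Complex.Gamma z‖ ≤
              C * ((k + 1) / (k + m)) := by
            refine (hC z hz m hm1).trans ?_
            rw [div_eq_mul_one_div]
            gcongr
          have h2 := hCG z hz
          gcongr
      _ = (C + C * S * (k + 1)) * ((k : ℝ) + 1) ^ (S + 1) / (k + m) := by
          field_simp
          ring
      _ ≤ ((1 + C + C * S) * (k + 1)) * ((k : ℝ) + 1) ^ (S + 1) / (k + m) := by
          gcongr
          nlinarith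
      _ = _ := by ring
  · subst hkn
    rw [if_pos le_rfl, Nat.sub_self, negBinomCoeff_zero, one_mul]
    have h1 : ‖(k : ℂ) ^ (1 - z)‖ ≤ ((k : ℝ) + 1) ^ S := by
      rw [natCast_cpow_eq_exp_log hn]
      have hl : 0 ≤ Real.log k := Real.log_natCast_nonneg k
      refine (Complex.norm_exp_le_exp_norm _).trans ?_
      rw [norm_mul, Complex.norm_real, Real.norm_of_nonneg hl]
      calc Real.exp (Real.log k * ‖1 - z‖) ≤ Real.exp (S * Real.log k) := by
            rw [mul_comm]
            gcongr
        _ = (k : ℝ) ^ S := by rw [Real.exp_nat_mul, Real.exp_log hn0]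
        _ ≤ _ := by
            gcongr
            linarith
    rw [le_div_iff₀ hn0]
    calc _ ≤ (((k : ℝ) + 1) ^ S + C) * k := by
          gcongr
          exact (norm_sub_le _ _).trans (add_le_add h1 (hCG z hz))
      _ ≤ (((k : ℝ) + 1) ^ S + C * ((k : ℝ) + 1) ^ S) * (k + 1) ^ 2 := by
          have h2 : (1 : ℝ) ≤ ((k : ℝ) + 1) ^ S := one_le_pow₀ hk1
          gcongr
          · exact le_mul_of_one_le_right hC0 h2
          · nlinarith
      _ = (1 + C) * ((k : ℝ) + 1) ^ (S + 2) := by ring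
      _ ≤ _ := mul_le_mul_of_nonneg_right (by linarith) (by positivity)
  -- no coefficient remains beyond `k = n`, and the bounded `1 / Γ(z)` is absorbed by `(1 + k) / n > 1`
  · rw [if_neg (by omega), zero_sub, norm_neg, le_div_iff₀ hn0]
    have h1 : (n : ℝ) ≤ k := by exact_mod_cast hkn.le
    calc _ ≤ C * ((k : ℝ) + 1) ^ 1 := by
          have := hCG z hz
          gcongr
          rw [pow_one]
          linarith
      _ ≤ _ := by
          gcongr
          · linarith
          · omega

/-- A radius slightly beyond `1 / q` at which all the series involved still converge. -/
theorem exists_radius {q A : ℝ} (hq : 1 < q) (hA : 1 ≤ A) (hAq : A < q) :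
    ∃ r : ℝ, 0 < r ∧ r ≤ 1 ∧ 1 < q * r ∧ q * r ^ 2 < 1 ∧ A * r < 1 := by
  have hsq : Real.sqrt q < q := by
    rw [Real.sqrt_lt' (by linarith)]
    nlinarith
  obtain ⟨s, hs1, hs2⟩ := exists_between (max_lt hAq hsq)
  have hsA : A < s := (le_max_left _ _).trans_lt hs1
  have hsq' : Real.sqrt q < s := (le_max_right _ _).trans_lt hs1
  have hs0 : 0 < s := by linarith
  refine ⟨1 / s, by positivity, ?_, ?_, ?_, ?_⟩
  · rw [div_le_one hs0]
    linarith
  · rw [mul_one_div, one_lt_div hs0]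
    exact hs2
  · rw [div_pow, mul_div_assoc', one_pow, mul_one, div_lt_one (by positivity)]
    exact (Real.sqrt_lt' hs0).1 hsq'
  · rw [mul_one_div, div_lt_one hs0]
    exact hsA

theorem proposition1p3 (F : Type*) [Field F] [Fintype F] :
    (∀ z : ℂ, ‖z‖ < (Fintype.card F : ℝ) → Multipliable (eulerFactor F z)) ∧
    ∀ ε : ℝ, 0 < ε → ε < (Fintype.card F : ℝ) →
      ∃ C : ℝ, ∀ z : ℂ, ‖z‖ ≤ (Fintype.card F : ℝ) - ε → ∀ n : ℕ, 1 ≤ n →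
        ∃ E : ℂ, ‖E‖ ≤ C / (n : ℝ) ∧
          omegaSum F z n =
            (Fintype.card F : ℂ) ^ n * (n : ℂ) ^ (z - 1) * (z * eulerH F z + E) := by
  refine ⟨fun z hz => (hasProd_eulerFactor hz).multipliable, fun ε hε0 _ => ?_⟩
  have hq1 : (1 : ℝ) < Fintype.card F := one_lt_card_real
  have hq0 : (Fintype.card F : ℂ) ≠ 0 := by exact_mod_cast Fintype.card_ne_zero
  -- the coefficient bounds need a radius of the disc that is at least `1`
  set A : ℝ := max 1 ((Fintype.card F : ℝ) - ε) with hAdef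
  have hA1 : 1 ≤ A := le_max_left _ _
  have hAq : A < Fintype.card F := max_lt hq1 (by linarith)
  obtain ⟨r, hr0, hr1, hqr, hqr2, hAr⟩ := exists_radius hq1 hA1 hAq
  obtain ⟨N, hN⟩ := exists_nat_ge (max 1
    (2 / r ^ 2 * ((1 - (Fintype.card F : ℝ) * r ^ 2)⁻¹ * (1 - A * r)⁻¹)))
  have hN1 : 1 ≤ N := by exact_mod_cast (le_max_left _ _).trans hN
  have hN2 := (le_max_right _ _).trans hN
  have hNN : (N : ℝ) ≤ (N : ℝ) ^ N := le_self_pow₀ (by exact_mod_cast hN1) (by omega)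
  obtain ⟨C, S, hC0, hC⟩ := exists_norm_shifted_negBinomCoeff_sub_le A (by linarith)
  set θ : ℝ := 1 / (Fintype.card F * r) with hθ
  have hθ0 : 0 ≤ θ := by positivity
  have hθ1 : θ < 1 := by rw [hθ, div_lt_one (by positivity)]; exact hqr
  have hT : Summable fun k : ℕ => ((k : ℝ) + 1) ^ S * θ ^ k := by
    have h1 := (summable_nat_add_iff 1).2
      (summable_pow_mul_geometric_of_norm_lt_one S (r := θ) (by
        rwa [Real.norm_of_nonneg hθ0]))
    refine (h1.mul_right θ⁻¹).congr fun k => ?_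
    have : θ ≠ 0 := by rw [hθ]; positivity
    push_cast
    rw [pow_succ]
    field_simp
  refine ⟨(N : ℝ) ^ N * C * ∑' k : ℕ, ((k : ℝ) + 1) ^ S * θ ^ k, fun z hz n hn => ?_⟩
  have hzA : ‖z‖ ≤ A := hz.trans (le_max_right _ _)
  obtain ⟨g, g0, grec, gconv⟩ := exists_omegaSum_eq_conv F z
  have hcsum : ∀ k : ℕ, ∑ i ∈ Finset.range k,
      ‖primePowerSum F z (i + 1) - z * (Fintype.card F : ℂ) ^ (i + 1)‖ * r ^ (i + 1) ≤ N :=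
    fun k => (sum_norm_primePowerSum_sub_mul_pow_le hA1 hr0 hr1 hqr2 hAr hzA k).trans hN2
  have hg := norm_mul_pow_le_of_recurrence hr0.le hN1 g0 grec hcsum
  have hc : ∀ k : ℕ, ‖primePowerSum F z (k + 1) - z * (Fintype.card F : ℂ) ^ (k + 1)‖ *
      r ^ (k + 1) ≤ (N : ℝ) ^ N := fun k =>
    ((Finset.single_le_sum (f := fun i : ℕ =>
      ‖primePowerSum F z (i + 1) - z * (Fintype.card F : ℂ) ^ (i + 1)‖ * r ^ (i + 1))
      (fun _ _ => by positivity) (Finset.self_mem_range_succ k)).trans (hcsum (k + 1))).trans hNN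
  have hur : ‖(1 / (Fintype.card F : ℂ))‖ < r := by
    rw [norm_div, norm_one, Complex.norm_natCast, div_lt_iff₀ (by linarith)]
    linarith
  have hH : z * eulerH F z = 1 / Complex.Gamma z * ∑' k, g k * (1 / (Fintype.card F : ℂ)) ^ k := by
    rw [eulerH, (hasProd_eulerFactor (hzA.trans_lt hAq)).tprod_eq,
      tsum_mul_pow_eq_exp_of_recurrence hr0 g0 grec hg hc hur, ← mul_assoc, one_div (Complex.Gamma (z + 1)),
      ← Complex.one_div_Gamma_eq_self_mul_one_div_Gamma_add_one, one_div (Complex.Gamma z)]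
  set γ : ℕ → ℂ := fun k => g k * (1 / (Fintype.card F : ℂ)) ^ k with hγ
  set t : ℕ → ℂ := fun k =>
    if k ≤ n then negBinomCoeff z (n - k) * (n : ℂ) ^ (1 - z) else 0 with ht
  have hγle : ∀ k, ‖γ k‖ ≤ (N : ℝ) ^ N * θ ^ k := by
    intro k
    have e : ‖γ k‖ = ‖g k‖ * r ^ k * θ ^ k := by
      rw [hγ, hθ]
      simp only
      rw [norm_mul, norm_pow, norm_div, norm_one, Complex.norm_natCast, mul_assoc, ← mul_pow]
      congr 2
      field_simp
    rw [e]
    exact mul_le_mul_of_nonneg_right (hg k) (by positivity)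
  have hterm : ∀ k : ℕ, ‖γ k * (t k - 1 / Complex.Gamma z)‖ ≤
      (N : ℝ) ^ N * C / n * (((k : ℝ) + 1) ^ S * θ ^ k) := by
    intro k
    rw [norm_mul]
    calc _ ≤ ((N : ℝ) ^ N * θ ^ k) * (C * ((k : ℝ) + 1) ^ S / n) := by
          gcongr
          · exact hγle k
          · exact hC z hzA n hn k
      _ = _ := by ring
  have hEs := hT.mul_left ((N : ℝ) ^ N * C / n)
  have hγs : Summable γ := Summable.of_norm_bounded
    ((summable_geometric_of_lt_one hθ0 hθ1).mul_left ((N : ℝ) ^ N)) hγle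
  -- `∑ γ_k t_k` is the normalised coefficient, and `∑ γ_k / Γ(z)` is its limit `z H(z)`
  refine ⟨∑' k, γ k * (t k - 1 / Complex.Gamma z), ?_, ?_⟩
  · refine (tsum_of_norm_bounded hEs.hasSum hterm).trans (le_of_eq ?_)
    rw [tsum_mul_left]
    ring
  · have hsum2 : z * eulerH F z + ∑' k, γ k * (t k - 1 / Complex.Gamma z) = ∑' k, γ k * t k := by
      rw [hH, ← tsum_mul_left, ← (hγs.mul_left _).tsum_add (Summable.of_norm_bounded hEs hterm)]
      exact tsum_congr fun k => by ring
    have hn0 : (n : ℂ) ≠ 0 := by exact_mod_cast (by omega : n ≠ 0)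
    have hpow : (n : ℂ) ^ (z - 1) * (n : ℂ) ^ (1 - z) = 1 := by
      rw [← Complex.cpow_add _ _ hn0]
      simp
    rw [hsum2, tsum_eq_sum (s := Finset.range (n + 1)), gconv, Finset.mul_sum]
    · refine Finset.sum_congr rfl fun k hk => ?_
      have hkn : k ≤ n := by
        rw [Finset.mem_range] at hk
        omega
      have hqk : (Fintype.card F : ℂ) ^ n * (1 / (Fintype.card F : ℂ)) ^ k =
          (Fintype.card F : ℂ) ^ (n - k) := by
        rw [one_div, inv_pow, ← div_eq_mul_inv, pow_sub₀ _ hq0 hkn, div_eq_mul_inv]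
      rw [ht, hγ]
      simp only
      rw [if_pos hkn, ← hqk]
      linear_combination (-(g k * negBinomCoeff z (n - k) * (Fintype.card F : ℂ) ^ n *
        (1 / (Fintype.card F : ℂ)) ^ k)) * hpow
    · intro k hk
      have hkn : ¬ k ≤ n := by
        rw [Finset.mem_range] at hk
        omega
      rw [ht]
      simp only
      rw [if_neg hkn, mul_zero]
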